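/- **Conventions.** For a field $K$ and an extension $K^\times\hookrightarrow U$ of abelian groups, $K\langle U\rangle$ denotes the universal commutative $K$-algebra with a group homomorphism $U\to K\langle U\rangle^\times$ that is the structure map on $K^\times$; explicitly $K\langle U\rangle=K\otimes_{K[K^\times]}K[U]$ (group algebras). It is graded by $D:=U/K^\times$, the component $K\langle U\rangle_d$ being the line spanned by the elements $x\in U$ of class $d$; for a subgroup $D'\subseteq D$ put $K\langle U\rangle_{D'}:=\bigoplus_{d\in D'}K\langle U\rangle_d$. The extension $K^\times\hookrightarrow U$ is called *co-Galois* if $K\langle U\rangle$ is a field, $D$ has no nontrivial elements of $\ell$-power order when $\operatorname{char}K=\ell>0$, and every intermediate field $K\subseteq E\subseteq K\langle U\rangle$ equals $K\langle U\rangle_{D'}$ for some subgroup $D'\subseteq D$. A field extension $L|K$ is called *co-Galois* if $L\cong K\langle U\rangle$ as $K$-algebras for some co-Galois extension $K^\times\hookrightarrow U$. For a positive integer $n$, $\mu_n(F)$ is the group of $n$-th roots of unity in a field $F$, and $\operatorname{ered}(n)$ is the product of the prime factors of $n$ if $4\nmid n$, and twice this product if $4\mid n$. **Lemma.** Let $L|K$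 be a finite Galois field extension with Galois group $G$ and let $n:=\exp(G)$. Assume $|\mu_n(L)|=n$ and $|\mu_{\operatorname{ered}(n)}(K)|=\operatorname{ered}(n)$. Let $U'\subseteq L^\times$ be the subgroup with $\mu_n(L)\subseteq U'$ and $U'/\mu_n(L)=(L^\times/\mu_n(L))^G$; it contains $K^\times$. Then: 1. $K\langle U'\rangle$ is a field, and the canonical map (the identity on $U'$) is an isomorphism of $K\langle U'\rangle$ onto the subalgebra $K[U']$ of $L$ generated by $U'$. 2. The canonical sequence $$1\longrightarrow \mu_n(L)/\mu_n(K)\longrightarrow U'/K^\times\longrightarrow H^1(G,\mu_n(L))\longrightarrow 1$$ is exact, where the first map is induced by the inclusion $\mu_n(L)\subseteq U'$ and the second sends the class of $u$ to the class of the cocycle $\sigma\mapsto\sigma(u)/u$. 3. The group extension $K^\times\hookrightarrow U'$ is co-Galois, the field $K[U']$ is a co-Galois and Galois extension of $K$, and it is the largest intermediate field of $L|K$ that is both Galois and co-Galois over $K$. -/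

import Mathlib

/-! ### The universal unitarily graded algebra of a group extension -/

section UniversalAlgebra

/-- For a homomorphism `ι : Aˣ →* U` into a commutative group (in practice an injective one, i.e. an
extension `Aˣ ↪ U`), the universal `A`-algebra `A⟨U⟩`. It is `A ⊗_{A[Aˣ]} A[U]`, that is, the group
algebra of `U` modulo the ideal that identifies the group element `ι a` with the scalar `a`. -/
abbrev UnivAlg {A U : Type*} [CommRing A] [CommGroup U] (ι : Aˣ →* U) : Type _ :=
  MonoidAlgebra A U ⧸ Ideal.span (Set.range fun a : Aˣ =>
    (MonoidAlgebra.of A U (ι a) - algebraMap A (MonoidAlgebra A U) (a : A)))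

namespace UnivAlg

variable {A U : Type*} [CommRing A] [CommGroup U] (ι : Aˣ →* U)

/-- The canonical homomorphism `γ : U → A⟨U⟩`. -/
noncomputable def gamma : U →* UnivAlg ι :=
  (Ideal.Quotient.mk _ : MonoidAlgebra A U →+* UnivAlg ι).toMonoidHom.comp (MonoidAlgebra.of A U)

/-- `γ` is the structure homomorphism of `A⟨U⟩` on `Aˣ`. -/
theorem gamma_base (a : Aˣ) : gamma ι (ι a) = algebraMap A (UnivAlg ι) (a : A) :=
  Ideal.Quotient.eq.2 (Ideal.subset_span ⟨a, rfl⟩)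

/-- The homogeneous component `A⟨U⟩_d`, for a degree `d` in `D = U / Aˣ`. -/
noncomputable def component (d : U ⧸ ι.range) : Submodule A (UnivAlg ι) :=
  Submodule.span A {x | ∃ u : U, (u : U ⧸ ι.range) = d ∧ gamma ι u = x}

/-- The graded part `A⟨U⟩_{D'} = ⨁_{d ∈ D'} A⟨U⟩_d`, for a subgroup `D'` of `D = U / Aˣ`. -/
noncomputable def gradedPart (D' : Subgroup (U ⧸ ι.range)) : Submodule A (UnivAlg ι) :=
  ⨆ d ∈ D', component ι d

end UnivAlg

end UniversalAlgebra

/-! ### Co-Galois extensions -/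

/-- The group extension `ι : Kˣ ↪ U`, with `D = U / Kˣ`, is co-Galois: `K⟨U⟩` is a field, `D` has no
`ℓ`-torsion if `K` has characteristic `ℓ > 0`, and every intermediate field `K ⊆ E ⊆ K⟨U⟩` is
graded, i.e. `E = K⟨U⟩_{D'}` for some subgroup `D'` of `D`. -/
structure IsCoGaloisGroupExtension {K U : Type*} [Field K] [CommGroup U] (ι : Kˣ →* U) : Prop where
  injective : Function.Injective ι
  isField : IsField (UnivAlg ι)
  torsion : ∀ ℓ : ℕ, ℓ.Prime → CharP K ℓ →
    ∀ (d : U ⧸ ι.range) (k : ℕ), d ^ ℓ ^ k = 1 → d = 1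
  graded : ∀ E : Subalgebra K (UnivAlg ι), IsField E →
    ∃ D' : Subgroup (U ⧸ ι.range), Subalgebra.toSubmodule E = UnivAlg.gradedPart ι D'

/-- The field extension `L|K` is co-Galois: `L ≅ K⟨U⟩` over `K` for some co-Galois group extension
`Kˣ ↪ U`. (Such a `U` embeds into `Lˣ`, so it may be taken in the universe of `L`.) -/
def IsCoGaloisExtension.{u, v} (K : Type u) (L : Type v) [Field K] [Field L] [Algebra K L] : Prop :=
  ∃ (U : Type v) (_ : CommGroup U) (ι : Kˣ →* U),
    IsCoGaloisGroupExtension ι ∧ Nonempty (L ≃ₐ[K] UnivAlg ι)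

/-! ### The extended reduction of a natural number -/

/-- The product of the prime factors of `n`, doubled if `4 ∣ n`. -/
def extendedReduction (n : ℕ) : ℕ :=
  if 4 ∣ n then 2 * ∏ p ∈ n.primeFactors, p else ∏ p ∈ n.primeFactors, p

/-! ### First cohomology with multiplicative coefficients

Mathlib's `groupCohomology.H1` over `ℤ` only accepts groups in `Type`; this is the same group of
1-cocycles modulo 1-coboundaries, with Mathlib's cocycle and coboundary conditions, in any universe. -/

section Cohomology

variable (G M : Type*) [Group G] [CommGroup M] [MulDistribMulAction G M]

/-- The group of 1-cocycles: functions `f` with `f (g h) = g • f h * f g`. -/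
def mulCocycles₁ : Subgroup (G → M) where
  carrier := {f | groupCohomology.IsMulCocycle₁ f}
  mul_mem' {a b} ha hb g h := by
    simp only [Pi.mul_apply, ha g h, hb g h, smul_mul']
    exact mul_mul_mul_comm _ _ _ _
  one_mem' g h := by simp
  inv_mem' {a} ha g h := by
    simp only [Pi.inv_apply, ha g h, smul_inv', mul_inv]

/-- The group of 1-coboundaries: functions of the form `g ↦ g • x / x`. -/
def mulCoboundaries₁ : Subgroup (G → M) where
  carrier := {f | groupCohomology.IsMulCoboundary₁ f}
  mul_mem' := by
    rintro a b ⟨x, hx⟩ ⟨y, hy⟩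
    exact ⟨x * y, fun g => by
      simp only [Pi.mul_apply, ← hx g, ← hy g, smul_mul', mul_div_mul_comm]⟩
  one_mem' := ⟨1, fun g => by simp⟩
  inv_mem' := by
    rintro a ⟨x, hx⟩
    exact ⟨x⁻¹, fun g => by
      simp only [Pi.inv_apply, ← hx g, smul_inv', div_eq_mul_inv, inv_inv, mul_comm, mul_inv]⟩

/-- `H¹(G, M)`, written multiplicatively. -/
abbrev MulH1 : Type _ :=
  mulCocycles₁ G M ⧸ (mulCoboundaries₁ G M).subgroupOf (mulCocycles₁ G M)

end Cohomology

/-! ### The group `U'` and the maps of the exact sequence -/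

section UPrime

variable (K L : Type*) [Field K] [Field L] [Algebra K L] (n : ℕ)

theorem galois_smul_mem_rootsOfUnity (σ : Gal(L/K)) {x : Lˣ} (hx : x ∈ rootsOfUnity n L) :
    σ • x ∈ rootsOfUnity n L := by
  rw [mem_rootsOfUnity] at hx ⊢
  rw [← smul_pow', hx, smul_one]

/-- The Galois action on `μ_n(L)`. -/
instance galoisActionRootsOfUnity : MulDistribMulAction Gal(L/K) (rootsOfUnity n L) where
  smul σ ζ := ⟨σ • (ζ : Lˣ), galois_smul_mem_rootsOfUnity K L n σ ζ.2⟩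
  one_smul ζ := Subtype.ext (one_smul _ (ζ : Lˣ))
  mul_smul σ τ ζ := Subtype.ext (mul_smul σ τ (ζ : Lˣ))
  smul_mul σ ζ ξ := Subtype.ext (smul_mul' σ (ζ : Lˣ) (ξ : Lˣ))
  smul_one σ := Subtype.ext (smul_one σ)

/-- The Galois action on `Lˣ / μ_n(L)` induced by the one on `Lˣ`. -/
instance galoisActionUnitsQuotient :
    MulDistribMulAction Gal(L/K) (Lˣ ⧸ rootsOfUnity n L) where
  smul σ := QuotientGroup.map (rootsOfUnity n L) (rootsOfUnity n L) (MulDistribMulAction.toMonoidHom Lˣ σ)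
    fun _ hx => galois_smul_mem_rootsOfUnity K L n σ hx
  one_smul x := QuotientGroup.induction_on x fun y =>
    congrArg (QuotientGroup.mk (s := rootsOfUnity n L)) (one_smul Gal(L/K) y)
  mul_smul σ τ x := QuotientGroup.induction_on x fun y =>
    congrArg (QuotientGroup.mk (s := rootsOfUnity n L)) (mul_smul σ τ y)
  smul_mul _ x y := map_mul (QuotientGroup.map _ _ _ _) x y
  smul_one _ := map_one (QuotientGroup.map _ _ _ _)

/-- The subgroup `U'` of `Lˣ` that contains `μ_n(L)` and satisfies
`U' / μ_n(L) = (Lˣ / μ_n(L))^G`, where `G = Gal(L/K)`. -/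
def uPrime : Subgroup Lˣ :=
  (FixedPoints.subgroup Gal(L/K) (Lˣ ⧸ rootsOfUnity n L)).comap
    (QuotientGroup.mk' (rootsOfUnity n L))

theorem rootsOfUnity_le_uPrime : rootsOfUnity n L ≤ uPrime K L n := by
  intro x hx σ
  have h : QuotientGroup.mk' (rootsOfUnity n L) x = 1 := (QuotientGroup.eq_one_iff x).2 hx
  rw [h, smul_one]

theorem smul_units_map_algebraMap (σ : Gal(L/K)) (a : Kˣ) :
    σ • Units.map (algebraMap K L).toMonoidHom a = Units.map (algebraMap K L).toMonoidHom a :=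
  Units.ext (σ.commutes (a : K))

theorem units_map_mem_uPrime (a : Kˣ) :
    Units.map (algebraMap K L).toMonoidHom a ∈ uPrime K L n := fun σ =>
  congrArg (QuotientGroup.mk (s := rootsOfUnity n L)) (smul_units_map_algebraMap K L σ a)

theorem smul_div_mem_rootsOfUnity {u : Lˣ} (hu : u ∈ uPrime K L n) (σ : Gal(L/K)) :
    σ • u / u ∈ rootsOfUnity n L :=
  (QuotientGroup.eq_iff_div_mem (N := rootsOfUnity n L)).1 (hu σ)

/-- The inclusion `Kˣ ↪ U'`. -/
def baseToUPrime : Kˣ →* uPrime K L n :=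
  (Units.map (algebraMap K L).toMonoidHom).codRestrict _ (units_map_mem_uPrime K L n)

/-- The map `μ_n(L)/μ_n(K) → U'/Kˣ` induced by the inclusion `μ_n(L) ⊆ U'`. -/
def rootsToUPrime :
    (rootsOfUnity n L ⧸ (restrictRootsOfUnity (algebraMap K L) n).range) →*
      (uPrime K L n ⧸ (baseToUPrime K L n).range) :=
  QuotientGroup.map _ _ (Subgroup.inclusion (rootsOfUnity_le_uPrime K L n)) <| by
    rintro _ ⟨ζ, rfl⟩
    exact ⟨(ζ : Kˣ), rfl⟩

/-- The 1-cocycle `σ ↦ σ(u)/u` with values in `μ_n(L)`, for `u` in `U'`. -/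
def uPrimeCocycle : uPrime K L n →* mulCocycles₁ Gal(L/K) (rootsOfUnity n L) where
  toFun u := ⟨fun σ => ⟨σ • (u : Lˣ) / u, smul_div_mem_rootsOfUnity K L n u.2 σ⟩, fun σ τ =>
    Subtype.ext <| show (σ * τ) • (u : Lˣ) / u = σ • (τ • (u : Lˣ) / u) * (σ • (u : Lˣ) / u) by
      rw [smul_div', mul_smul, div_mul_div_cancel]⟩
  map_one' := Subtype.ext <| funext fun σ => Subtype.ext <|
    show σ • (1 : Lˣ) / 1 = 1 by simp
  map_mul' u v := Subtype.ext <| funext fun σ => Subtype.ext <|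
    show σ • ((u : Lˣ) * v) / (u * v) = σ • (u : Lˣ) / u * (σ • (v : Lˣ) / v) by
      rw [smul_mul', mul_div_mul_comm]

/-- The connecting map `U'/Kˣ → H¹(G, μ_n(L))`, sending the class of `u` to the class of the
cocycle `σ ↦ σ(u)/u`. -/
def uPrimeToH1 :
    (uPrime K L n ⧸ (baseToUPrime K L n).range) →* MulH1 Gal(L/K) (rootsOfUnity n L) :=
  QuotientGroup.lift _ ((QuotientGroup.mk' _).comp (uPrimeCocycle K L n)) <| by
    rintro _ ⟨a, rfl⟩
    have h : uPrimeCocycle K L n (baseToUPrime K L n a) = 1 :=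
      Subtype.ext <| funext fun σ => Subtype.ext <|
        show σ • Units.map (algebraMap K L).toMonoidHom a
          / Units.map (algebraMap K L).toMonoidHom a = 1 by
          rw [smul_units_map_algebraMap, div_self']
    rw [MonoidHom.mem_ker, MonoidHom.comp_apply, h, map_one]

end UPrime

/-! Traces recover the grading. An element `u` of U' has `u ^ n` in K. Over an intermediate field F,
let `m` be minimal with `u ^ m = b` in F. As K contains the p-th roots of unity for p ∣ n, and i if
4 ∣ n, `X ^ m - b` is irreducible, so `u` has trace 0 over F unless it lies in F
(`trace_eq_zero_of_pow_mem`).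

For F = K, the trace of L pulls back to K⟨U'⟩ as [L:K] times the projection to degree 1. The pairing
given by this projection is nondegenerate and [L:K] is invertible, so K⟨U'⟩ embeds in L. For general
F, the trace to F sends each element of U' to a multiple of itself lying in F, or to 0; hence
subfields are graded. Exactness is Galois descent plus Hilbert 90.

For maximality, let E ≅ K⟨U⟩ be Galois in L. It suffices that U/Kˣ has exponent dividing n
(`orderOf_dvd_of_forall_pow_eq_one`). If v has order q = p^k there, k ≥ 1, some σ multiplies v by a
primitive q-th root of unity ζ, and σζ = ζ^s. Then σ^n = 1 gives q ∣ 1 + s + ⋯ + s^(n-1), and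
lifting the exponent gives q ∣ n for k ≥ 2. For p = 2 this needs s ≡ 1 mod 4, i.e. i in K, which
`four_dvd_of_orderOf_eq_four` secures. -/

namespace UnivAlg

/-! ### The algebra K⟨U⟩: universal property, basis, projection to degree 1 -/

section

variable {A U : Type*} [CommRing A] [CommGroup U] (ι : Aˣ →* U)

/-- The homogeneous elements `γ(u)` span `A⟨U⟩`. -/
theorem span_range_gamma : Submodule.span A (Set.range (gamma ι)) = ⊤ := by
  rw [eq_top_iff]
  rintro x -
  obtain ⟨y, rfl⟩ := Ideal.Quotient.mk_surjective x
  induction y using MonoidAlgebra.induction_on with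
  | of u => exact Submodule.subset_span ⟨u, rfl⟩
  | add f g hf hg => rw [map_add]; exact add_mem hf hg
  | smul r f hf => exact Submodule.smul_mem _ r hf

theorem linearMap_ext {M : Type*} [AddCommGroup M] [Module A M] {f g : UnivAlg ι →ₗ[A] M}
    (h : ∀ u, f (gamma ι u) = g (gamma ι u)) : f = g :=
  LinearMap.ext_on_range (span_range_gamma ι) h

theorem gamma_mul_gamma_inv (u : U) : gamma ι u * gamma ι u⁻¹ = 1 := by
  rw [← map_mul, mul_inv_cancel, map_one]

variable {B : Type*} [CommRing B] [Algebra A B]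

/-- The universal property of `A⟨U⟩`. -/
noncomputable def lift (f : U →* B) (hf : ∀ a : Aˣ, f (ι a) = algebraMap A B a) :
    UnivAlg ι →ₐ[A] B :=
  Ideal.Quotient.liftₐ _ (MonoidAlgebra.lift A B U f) <| by
    intro x hx
    refine (Ideal.span_le (I := RingHom.ker (MonoidAlgebra.lift A B U f))).2 ?_ hx
    rintro _ ⟨a, rfl⟩
    simp only [SetLike.mem_coe, RingHom.mem_ker, map_sub, AlgHom.commutes]
    rw [MonoidAlgebra.lift_of, hf, sub_self]

@[simp]
theorem lift_gamma (f : U →* B) (hf : ∀ a : Aˣ, f (ι a) = algebraMap A B a) (u : U) :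
    lift ι f hf (gamma ι u) = f u :=
  MonoidAlgebra.lift_of f u

end

section Field

variable {K U : Type*} [Field K] [CommGroup U] (ι : Kˣ →* U)

open Classical in
/-- The value at `u` of the projection of `K⟨U⟩` onto the component of degree `1`. -/
noncomputable def baseValue (u : U) : K := if h : ∃ a, ι a = u then (h.choose : K) else 0

variable {ι} in
theorem baseValue_base (hι : Function.Injective ι) (a : Kˣ) : baseValue ι (ι a) = a := by
  have h : ∃ b, ι b = ι a := ⟨a, rfl⟩
  rw [baseValue, dif_pos h, hι h.choose_spec]

theorem baseValue_of_notMem {u : U} (hu : u ∉ ι.range) : baseValue ι u = 0 :=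
  dif_neg hu

variable {ι} in
theorem baseValue_mul (hι : Function.Injective ι) (a : Kˣ) (u : U) :
    baseValue ι (ι a * u) = a * baseValue ι u := by
  by_cases hu : u ∈ ι.range
  · obtain ⟨b, rfl⟩ := hu
    rw [← map_mul, baseValue_base hι, baseValue_base hι, Units.val_mul]
  · rw [baseValue_of_notMem ι hu, mul_zero, baseValue_of_notMem]
    rwa [Subgroup.mul_mem_cancel_left _ (MonoidHom.mem_range.2 ⟨a, rfl⟩)]

variable {ι}

variable (ι) in
/-- The linear form on the group algebra that takes the values `baseValue ι` on `U`. -/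
noncomputable def baseForm : MonoidAlgebra K U →ₗ[K] K :=
  (Finsupp.linearCombination K (baseValue ι)).comp (MonoidAlgebra.coeffLinearEquiv K).toLinearMap

theorem baseForm_of (u : U) : baseForm ι (MonoidAlgebra.of K U u) = baseValue ι u := by
  simp [baseForm, MonoidAlgebra.of]

/-- This lets the form descend to the quotient K⟨U⟩. -/
theorem baseForm_mul_relation (hι : Function.Injective ι) (r : MonoidAlgebra K U) (a : Kˣ) :
    baseForm ι (r * (MonoidAlgebra.of K U (ι a) - algebraMap K (MonoidAlgebra K U) (a : K))) =
      0 := by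
  induction r using MonoidAlgebra.induction_on with
  | of u =>
    rw [mul_sub, map_sub, ← map_mul, baseForm_of, mul_comm u, baseValue_mul hι,
      mul_comm (MonoidAlgebra.of K U u), ← Algebra.smul_def, map_smul, baseForm_of, smul_eq_mul, sub_self]
  | add f g hf hg => rw [add_mul, map_add, hf, hg, add_zero]
  | smul r f hf => rw [smul_mul_assoc, map_smul, hf, smul_zero]

/-- The projection of `K⟨U⟩` onto its component of degree `1`, which is `K`. -/
noncomputable def baseCoeff (hι : Function.Injective ι) : UnivAlg ι →ₗ[K] K :=
  (Submodule.liftQ ((Ideal.span (Set.range fun a : Kˣ =>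
    (MonoidAlgebra.of K U (ι a) - algebraMap K (MonoidAlgebra K U) (a : K)))).restrictScalars K)
    (baseForm ι) <| by
    intro x hx
    rw [Submodule.restrictScalars_mem] at hx
    rw [LinearMap.mem_ker]
    -- The multiplier `r` absorbs the ideal coefficients in the induction.
    suffices ∀ r, baseForm ι (r * x) = 0 by simpa using this 1
    induction hx using Submodule.span_induction with
    | mem x hx => obtain ⟨a, rfl⟩ := hx; exact fun r => baseForm_mul_relation hι r a
    | zero => simp
    | add x y _ _ hx hy => intro r; rw [mul_add, map_add, hx, hy, add_zero]
    | smul s x _ hx => intro r; rw [smul_eq_mul, ← mul_assoc, hx]) ∘ₗ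
  (Submodule.Quotient.restrictScalarsEquiv K _).symm.toLinearMap

theorem baseCoeff_gamma (hι : Function.Injective ι) (u : U) :
    baseCoeff hι (gamma ι u) = baseValue ι u :=
  baseForm_of u

theorem baseCoeff_gamma_of_notMem (hι : Function.Injective ι) {u : U} (hu : u ∉ ι.range) :
    baseCoeff hι (gamma ι u) = 0 := by
  rw [baseCoeff_gamma, baseValue_of_notMem ι hu]

theorem baseCoeff_one (hι : Function.Injective ι) : baseCoeff hι 1 = 1 := by
  rw [← map_one (gamma ι), baseCoeff_gamma, ← map_one ι, baseValue_base hι, Units.val_one]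

theorem baseCoeff_algebraMap (hι : Function.Injective ι) (a : K) :
    baseCoeff hι (algebraMap K _ a) = a := by
  rw [Algebra.algebraMap_eq_smul_one, map_smul, baseCoeff_one, smul_eq_mul, mul_one]

/-- A homogeneous element that is a scalar has degree `1`. -/
theorem mem_range_of_gamma_eq (hι : Function.Injective ι) {u : U} {a : K}
    (h : gamma ι u = algebraMap K _ a) : u ∈ ι.range := by
  by_contra hu
  have h0 := baseCoeff_gamma_of_notMem hι hu
  rw [h, baseCoeff_algebraMap] at h0
  have h1 := gamma_mul_gamma_inv ι u
  rw [h, h0, map_zero, zero_mul] at h1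
  have := baseCoeff_one hι
  rw [← h1, map_zero] at this
  exact zero_ne_one this

theorem exists_gamma_eq_smul {u v : U} (h : (u : U ⧸ ι.range) = v) :
    ∃ a : Kˣ, gamma ι u = (a : K) • gamma ι v := by
  obtain ⟨a, ha⟩ := QuotientGroup.eq_iff_div_mem.1 h
  refine ⟨a, ?_⟩
  calc gamma ι u = algebraMap K _ (a : K) * gamma ι v := by
        rw [← gamma_base, ← map_mul, ha, div_mul_cancel]
    _ = (a : K) • gamma ι v := (Algebra.smul_def _ _).symm

/-- Multiplying by the inverse of a representative of `d` moves degree `d` to degree 1, where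
`baseCoeff` reads off the coefficient and kills all other degrees. -/
theorem linearIndependent_gamma_out (hι : Function.Injective ι) :
    LinearIndependent K fun d : U ⧸ ι.range => gamma ι d.out := by
  rw [linearIndependent_iff']
  intro s c hc d hd
  have h := congrArg (fun x => baseCoeff hι (gamma ι d.out⁻¹ * x)) hc
  simp only [Finset.mul_sum, mul_smul_comm, map_sum, map_smul, mul_zero, map_zero] at h
  rw [Finset.sum_eq_single_of_mem d hd, mul_comm, gamma_mul_gamma_inv, baseCoeff_one, smul_eq_mul,
    mul_one] at h
  · exact h
  · intro e _ he
    rw [← map_mul, baseCoeff_gamma_of_notMem hι, smul_zero]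
    intro hmem
    apply he
    have := QuotientGroup.eq.2 hmem
    rw [QuotientGroup.out_eq', QuotientGroup.out_eq'] at this
    exact this.symm

/-- Representatives of the degrees form a basis of `K⟨U⟩`. -/
noncomputable def basis (hι : Function.Injective ι) :
    Module.Basis (U ⧸ ι.range) K (UnivAlg ι) :=
  .mk (linearIndependent_gamma_out hι) <| by
    rw [← span_range_gamma, Submodule.span_le]
    rintro _ ⟨u, rfl⟩
    obtain ⟨a, ha⟩ := exists_gamma_eq_smul (QuotientGroup.out_eq' (u : U ⧸ ι.range)).symm
    rw [ha]
    exact Submodule.smul_mem _ _ (Submodule.subset_span ⟨_, rfl⟩)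

/-- The pairing `(x, y) ↦ baseCoeff (x y)` is nondegenerate. -/
theorem eq_zero_of_baseCoeff_mul_gamma (hι : Function.Injective ι) {x : UnivAlg ι}
    (h : ∀ u, baseCoeff hι (x * gamma ι u) = 0) : x = 0 := by
  refine (basis hι).ext_elem fun d => ?_
  have hd := h d.out⁻¹
  have hc : baseCoeff hι ∘ₗ LinearMap.mulRight K (gamma ι d.out⁻¹) =
      (basis hι).coord d := by
    refine (basis hι).ext fun e => ?_
    rw [Module.Basis.coord_apply, Module.Basis.repr_self, LinearMap.comp_apply,
      LinearMap.mulRight_apply, basis, Module.Basis.mk_apply, ← map_mul]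
    by_cases he : e = d
    · rw [he, mul_inv_cancel, map_one, baseCoeff_one, Finsupp.single_eq_same]
    · rw [baseCoeff_gamma_of_notMem, Finsupp.single_eq_of_ne (Ne.symm he)]
      intro hmem
      apply he
      rw [← div_eq_mul_inv] at hmem
      have := QuotientGroup.eq_iff_div_mem.2 hmem
      rwa [QuotientGroup.out_eq', QuotientGroup.out_eq'] at this
  have hx := LinearMap.congr_fun hc x
  rw [LinearMap.comp_apply, LinearMap.mulRight_apply, hd, Module.Basis.coord_apply] at hx
  rw [← hx, map_zero, Finsupp.zero_apply]

theorem mem_gradedPart {D' : Subgroup (U ⧸ ι.range)} {u : U} (hu : (u : U ⧸ ι.range) ∈ D') :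
    gamma ι u ∈ gradedPart ι D' :=
  Submodule.mem_iSup_of_mem (u : U ⧸ ι.range)
    (Submodule.mem_iSup_of_mem hu (Submodule.subset_span ⟨u, rfl, rfl⟩))

theorem gradedPart_le {D' : Subgroup (U ⧸ ι.range)} {M : Submodule K (UnivAlg ι)}
    (h : ∀ u : U, (u : U ⧸ ι.range) ∈ D' → gamma ι u ∈ M) : gradedPart ι D' ≤ M := by
  refine iSup₂_le fun d hd => Submodule.span_le.2 ?_
  rintro _ ⟨u, rfl, rfl⟩
  exact h u hd

end Field

end UnivAlg

/-! ### Irreducible binomials and vanishing traces -/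

section Kummer

open Polynomial IntermediateField

/-- If `a` is not a `p`-th power for the primes `p ∣ n`, and `-1` is a square in case `4 ∣ n`, then
`X ^ n - a` is irreducible. -/
theorem X_pow_sub_C_irreducible_of_isSquare_neg_one.{u} {K : Type u} [Field K] {n : ℕ} (hn : n ≠ 0)
    (hi : 4 ∣ n → ∃ i : K, i ^ 2 = -1) {a : K}
    (ha : ∀ p : ℕ, p.Prime → p ∣ n → ∀ b : K, b ^ p ≠ a) :
    Irreducible (X ^ n - C a) := by
  induction n using induction_on_primes generalizing K a with
  | zero => exact absurd rfl hn
  | one => simpa using irreducible_X_sub_C a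
  | prime_mul p n hp IH =>
    rw [mul_comm]
    apply X_pow_mul_sub_C_irreducible
      (X_pow_sub_C_irreducible_of_prime hp (ha p hp (dvd_mul_right _ _)))
    intro E _ _ x hx
    have : IsIntegral K x := not_not.mp fun h ↦ by
      simpa only [degree_zero, degree_X_pow_sub_C hp.pos,
        WithBot.natCast_ne_bot] using congr_arg degree (hx.symm.trans (dif_neg h))
    apply IH (right_ne_zero_of_mul hn)
    · intro h4
      obtain ⟨i, hi⟩ := hi (h4.trans (dvd_mul_left _ _))
      exact ⟨algebraMap K _ i, by rw [← map_pow, hi, map_neg, map_one]⟩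
    intro q hq hqn b hb
    -- If `b` is a q-th root of `x`, its norm is a q-th root of N(x) = ±a. An odd `p` or `q` absorbs
    -- the sign; for p = q = 2 a square root of -1 does.
    have key : Algebra.norm K b ^ q = (-1) ^ p * -a := by
      rw [← map_pow, hb, ← adjoin.powerBasis_gen this,
        Algebra.PowerBasis.norm_gen_eq_coeff_zero_minpoly]
      simp [minpoly_gen, hx, hp.ne_zero.symm]
    rcases hp.eq_two_or_odd' with rfl | hodd
    · rcases hq.eq_two_or_odd' with rfl | hodd'
      · obtain ⟨i, hi⟩ := hi (mul_dvd_mul_left 2 hqn)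
        exact ha 2 hq (dvd_mul_right _ _) (i * Algebra.norm K b) (by rw [mul_pow, key, hi]; ring)
      · exact ha q hq (dvd_mul_of_dvd_right hqn 2) (-Algebra.norm K b)
          (by rw [hodd'.neg_pow, key]; ring)
    · exact ha q hq (dvd_mul_of_dvd_right hqn p) (Algebra.norm K b)
        (by rw [key, hodd.neg_one_pow]; ring)

/-- An element of `Lˣ` of finite order modulo `Fˣ` that is not in `F` has trace `0` if `F` contains
enough roots of unity. -/
theorem trace_eq_zero_of_pow_mem {F L : Type*} [Field F] [Field L] [Algebra F L]
    [FiniteDimensional F L] {n : ℕ} (hn : n ≠ 0)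
    (hp : ∀ p : ℕ, p.Prime → p ∣ n → ∀ x : L, x ^ p = 1 → x ∈ Set.range (algebraMap F L))
    (hi : 4 ∣ n → ∃ i : F, i ^ 2 = -1) {u : L} (hu : u ≠ 0)
    (hun : u ^ n ∈ Set.range (algebraMap F L)) (huF : u ∉ Set.range (algebraMap F L)) :
    Algebra.trace F L u = 0 := by
  classical
  -- `m` is the order of `u` modulo Fˣ.
  have hex : ∃ m, 0 < m ∧ u ^ m ∈ (algebraMap F L).fieldRange := ⟨n, hn.bot_lt, hun⟩
  set m := Nat.find hex with hm
  obtain ⟨hm0, b, hb⟩ := Nat.find_spec hex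
  rw [← hm] at hm0 hb
  have hmin : ∀ k, u ^ k ∈ (algebraMap F L).fieldRange → m ∣ k := by
    intro k hk
    rw [Nat.dvd_iff_mod_eq_zero]
    by_contra h
    refine Nat.find_min hex (Nat.mod_lt k hm0) ⟨Nat.pos_of_ne_zero h, ?_⟩
    have h1 : u ^ (k % m) = u ^ k / (u ^ m) ^ (k / m) := by
      rw [eq_div_iff (pow_ne_zero _ (pow_ne_zero _ hu)), ← pow_mul, ← pow_add, Nat.mod_add_div]
    rw [h1, ← hb]
    exact div_mem hk (pow_mem (RingHom.mem_fieldRange.2 ⟨b, rfl⟩) _)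
  have hmn : m ∣ n := hmin n hun
  have hirr : Irreducible (X ^ m - C b) := by
    refine X_pow_sub_C_irreducible_of_isSquare_neg_one hm0.ne' (fun h => hi (h.trans hmn)) ?_
    -- If b = c^p and m = pk, then u^k / c is a p-th root of unity, so u^k lies in F, against the
    -- minimality of `m`.
    rintro p hpp ⟨k, hk⟩ c rfl
    have hk0 : 0 < k := Nat.pos_of_ne_zero fun h => hm0.ne' (by rw [hk, h, mul_zero])
    have hc : algebraMap F L c ≠ 0 := by
      intro h0
      rw [map_pow, h0, zero_pow hpp.ne_zero] at hb
      exact pow_ne_zero _ hu hb.symm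
    obtain ⟨d, hd⟩ := hp p hpp (Dvd.intro k hk.symm |>.trans hmn) (u ^ k / algebraMap F L c) (by
      rw [div_pow, ← map_pow, hb, ← pow_mul, mul_comm k, ← hk, div_self (pow_ne_zero _ hu)])
    have : m ∣ k := hmin k ⟨d * c, by rw [map_mul, hd, div_mul_cancel₀ _ hc]⟩
    have := Nat.le_of_dvd hk0 this
    rw [hk] at this
    exact absurd this (not_le.2 (lt_mul_of_one_lt_left hk0 hpp.one_lt))
  have hmp : minpoly F u = X ^ m - C b :=
    (minpoly.eq_of_irreducible_of_monic hirr (by simp [hb]) (monic_X_pow_sub_C b hm0.ne')).symm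
  -- With m ≥ 2, the coefficient of X^(m-1) in the minimal polynomial vanishes.
  have hm1 : m ≠ 1 := fun h => huF ⟨b, by rw [hb, h, pow_one]⟩
  rw [trace_eq_finrank_mul_minpoly_nextCoeff, hmp, nextCoeff_of_natDegree_pos
    (by rwa [natDegree_X_pow_sub_C]), natDegree_X_pow_sub_C, coeff_sub, coeff_X_pow, coeff_C,
    if_neg (by omega), if_neg (by omega), sub_zero, neg_zero, mul_zero]

end Kummer

/-! ### Roots of unity, extended reduction and exponent -/

section RootsOfUnity

theorem exists_isPrimitiveRoot_of_card_rootsOfUnity {F : Type*} [Field F] {m : ℕ} (hm : m ≠ 0)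
    (h : Nat.card (rootsOfUnity m F) = m) : ∃ ζ : F, IsPrimitiveRoot ζ m := by
  have : NeZero m := ⟨hm⟩
  obtain ⟨g, hg⟩ := IsCyclic.exists_ofOrder_eq_natCard (α := rootsOfUnity m F)
  rw [h] at hg
  refine ⟨((g : Fˣ) : F), ?_⟩
  rw [IsPrimitiveRoot.coe_units_iff, IsPrimitiveRoot.coe_submonoidClass_iff]
  exact IsPrimitiveRoot.iff_orderOf.2 hg

theorem extendedReduction_ne_zero (n : ℕ) : extendedReduction n ≠ 0 := by
  have h : ∏ p ∈ n.primeFactors, p ≠ 0 :=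
    Finset.prod_ne_zero_iff.2 fun p hp => (Nat.prime_of_mem_primeFactors hp).ne_zero
  unfold extendedReduction
  split_ifs
  · exact mul_ne_zero two_ne_zero h
  · exact h

theorem Nat.Prime.dvd_extendedReduction {n p : ℕ} (hn : n ≠ 0) (hp : p.Prime) (h : p ∣ n) :
    p ∣ extendedReduction n := by
  have h : p ∣ ∏ p ∈ n.primeFactors, p :=
    Finset.dvd_prod_of_mem (fun p => p) (Nat.mem_primeFactors.2 ⟨hp, h, hn⟩)
  unfold extendedReduction
  split_ifs
  · exact h.mul_left 2
  · exact h

theorem four_dvd_extendedReduction {n : ℕ} (hn : n ≠ 0) (h : 4 ∣ n) :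
    4 ∣ extendedReduction n := by
  have h2 : 2 ∣ ∏ p ∈ n.primeFactors, p :=
    Finset.dvd_prod_of_mem (fun p => p)
      (Nat.mem_primeFactors.2 ⟨Nat.prime_two, (by norm_num : 2 ∣ 4).trans h, hn⟩)
  rw [extendedReduction, if_pos h]
  exact mul_dvd_mul_left 2 h2

theorem IsPrimitiveRoot.sq_eq_neg_one {F : Type*} [Field F] {i : F} (hi : IsPrimitiveRoot i 4) :
    i ^ 2 = -1 :=
  (hi.pow (by norm_num) (by norm_num : 4 = 2 * 2)).eq_neg_one_of_two_right

theorem mem_range_of_pow_eq_one {K L : Type*} [Field K] [Field L] [Algebra K L] {p : ℕ}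
    (hp : p ≠ 0) {ζ : K} (hζ : IsPrimitiveRoot ζ p) {x : L} (hx : x ^ p = 1) :
    x ∈ Set.range (algebraMap K L) := by
  have : NeZero p := ⟨hp⟩
  obtain ⟨i, -, rfl⟩ :=
    (hζ.map_of_injective (algebraMap K L).injective).eq_pow_of_pow_eq_one hx
  exact ⟨ζ ^ i, map_pow _ _ _⟩

theorem Nat.Prime.dvd_exponent {G : Type*} [Group G] [Finite G] {p : ℕ} (hp : p.Prime)
    (h : p ∣ Nat.card G) : p ∣ Monoid.exponent G := by
  have := Fact.mk hp
  obtain ⟨g, hg⟩ := exists_prime_orderOf_dvd_card' p h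
  rw [← hg]
  exact Monoid.order_dvd_exponent g

/-- By Cauchy, |G| and exp(G) have the same prime divisors, so field degrees are invertible once the
exponent is. -/
theorem natCast_ne_zero_of_dvd_card {G F : Type*} [Group G] [Finite G] [Field F] {m : ℕ}
    (hm : m ∣ Nat.card G) (h : (Monoid.exponent G : F) ≠ 0) : (m : F) ≠ 0 := by
  intro h0
  obtain ⟨p, hp⟩ := CharP.exists F
  rw [CharP.cast_eq_zero_iff F p] at h0
  rcases CharP.char_is_prime_or_zero F p with hpp | rfl
  · exact h ((CharP.cast_eq_zero_iff F p _).2 (hpp.dvd_exponent (h0.trans hm)))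
  · exact Nat.card_pos.ne' (Nat.eq_zero_of_zero_dvd ((zero_dvd_iff.1 h0) ▸ hm))

end RootsOfUnity

/-! ### Embedding K⟨U'⟩ in L, and its graded subalgebras -/

section UPrimeAlgebra

open UnivAlg

variable {K L : Type*} [Field K] [Field L] [Algebra K L] {n : ℕ}

theorem baseToUPrime_injective : Function.Injective (baseToUPrime K L n) := by
  intro a b h
  have h1 : Units.map (algebraMap K L).toMonoidHom a = Units.map (algebraMap K L).toMonoidHom b :=
    congrArg Subtype.val h
  exact Units.map_injective (f := (algebraMap K L).toMonoidHom) (algebraMap K L).injective h1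

theorem mem_range_baseToUPrime {u : uPrime K L n}
    (hu : ((u : Lˣ) : L) ∈ Set.range (algebraMap K L)) : u ∈ (baseToUPrime K L n).range := by
  obtain ⟨a, ha⟩ := hu
  have ha0 : a ≠ 0 := by
    rintro rfl
    rw [map_zero] at ha
    exact (u : Lˣ).ne_zero ha.symm
  exact ⟨Units.mk0 a ha0, Subtype.ext (Units.ext ha)⟩

/-- Invariance modulo μ_n(L) becomes invariance of the n-th power, which Galois descent places in K.
-/
theorem mem_uPrime_iff {u : Lˣ} :
    u ∈ uPrime K L n ↔ ∀ σ : Gal(L/K), σ (u : L) ^ n = (u : L) ^ n := by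
  have key : ∀ σ : Gal(L/K), σ • u / u ∈ rootsOfUnity n L ↔ σ (u : L) ^ n = (u : L) ^ n := by
    intro σ
    rw [mem_rootsOfUnity, div_pow, div_eq_one, Units.ext_iff]
    rfl
  constructor
  · exact fun h σ => (key σ).1 (smul_div_mem_rootsOfUnity K L n h σ)
  · exact fun h σ => (QuotientGroup.eq_iff_div_mem (N := rootsOfUnity n L)).2 ((key σ).2 (h σ))

theorem pow_mem_range_of_mem_uPrime [FiniteDimensional K L] [IsGalois K L] {u : Lˣ}
    (hu : u ∈ uPrime K L n) : (u : L) ^ n ∈ Set.range (algebraMap K L) := by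
  rw [IsGalois.mem_range_algebraMap_iff_fixed]
  intro σ
  rw [map_pow, mem_uPrime_iff.1 hu]

variable (K L n)

/-- The canonical homomorphism `K⟨U'⟩ → L`. -/
noncomputable def uPrimeToField : UnivAlg (baseToUPrime K L n) →ₐ[K] L :=
  lift _ ((Units.coeHom L).comp (uPrime K L n).subtype) fun _ => rfl

variable {K L n}

theorem uPrimeToField_gamma (u : uPrime K L n) :
    uPrimeToField K L n (gamma _ u) = ((u : Lˣ) : L) :=
  lift_gamma _ _ _ u

theorem range_uPrimeToField :
    (uPrimeToField K L n).range =
      Algebra.adjoin K ((fun u : Lˣ => (u : L)) '' (uPrime K L n : Set Lˣ)) := by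
  apply le_antisymm
  · rintro _ ⟨x, rfl⟩
    have hx : x ∈ Submodule.span K (Set.range (gamma (baseToUPrime K L n))) := by
      rw [span_range_gamma]; trivial
    induction hx using Submodule.span_induction with
    | mem x hx =>
      obtain ⟨u, rfl⟩ := hx
      exact (uPrimeToField_gamma u).symm ▸ Algebra.subset_adjoin ⟨u, u.2, rfl⟩
    | zero => exact (map_zero (uPrimeToField K L n)).symm ▸ zero_mem _
    | add x y _ _ hx hy => exact (map_add (uPrimeToField K L n) x y).symm ▸ add_mem hx hy
    | smul a x _ hx =>
      exact (map_smul (uPrimeToField K L n) a x).symm ▸ Subalgebra.smul_mem _ hx a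
  · rw [Algebra.adjoin_le_iff]
    rintro _ ⟨u, hu, rfl⟩
    exact ⟨gamma _ ⟨u, hu⟩, uPrimeToField_gamma ⟨u, hu⟩⟩

variable [FiniteDimensional K L] [IsGalois K L]

/-- Over an intermediate field `F`, an element of `U'` outside `F` has trace `0`. -/
theorem trace_eq_zero_of_mem_uPrime (hn : n ≠ 0)
    (hp : ∀ p : ℕ, p.Prime → p ∣ n → ∃ ζ : K, IsPrimitiveRoot ζ p)
    (hi : 4 ∣ n → ∃ i : K, i ^ 2 = -1) (F : IntermediateField K L) {u : Lˣ}
    (hu : u ∈ uPrime K L n) (huF : (u : L) ∉ F) : Algebra.trace F L (u : L) = 0 := by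
  have hKF : Set.range (algebraMap K L) ⊆ Set.range (algebraMap F L) := by
    rintro _ ⟨a, rfl⟩
    exact ⟨algebraMap K F a, rfl⟩
  refine trace_eq_zero_of_pow_mem hn ?_ ?_ u.ne_zero (hKF (pow_mem_range_of_mem_uPrime hu)) ?_
  · intro p hpp hpn x hx
    obtain ⟨ζ, hζ⟩ := hp p hpp hpn
    exact hKF (mem_range_of_pow_eq_one hpp.ne_zero hζ hx)
  · intro h4
    obtain ⟨i, hi⟩ := hi h4
    exact ⟨algebraMap K F i, by rw [← map_pow, hi, map_neg, map_one]⟩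
  · rintro ⟨x, hx⟩
    exact huF (hx ▸ x.2)

/-- The trace vanishes on elements of U' outside K and is multiplication by [L:K] on K, so it agrees
with the degree-1 coefficient up to this factor. -/
theorem trace_uPrimeToField (hn : n ≠ 0)
    (hp : ∀ p : ℕ, p.Prime → p ∣ n → ∃ ζ : K, IsPrimitiveRoot ζ p)
    (hi : 4 ∣ n → ∃ i : K, i ^ 2 = -1) (x : UnivAlg (baseToUPrime K L n)) :
    Algebra.trace K L (uPrimeToField K L n x) =
      Module.finrank K L • baseCoeff (baseToUPrime_injective (K := K) (L := L)) x := by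
  have key : Algebra.trace K L ∘ₗ (uPrimeToField K L n).toLinearMap =
      Module.finrank K L • baseCoeff (baseToUPrime_injective (K := K) (L := L)) := by
    refine linearMap_ext _ fun u => ?_
    rw [LinearMap.comp_apply, AlgHom.toLinearMap_apply, uPrimeToField_gamma, LinearMap.smul_apply]
    by_cases hu : ((u : Lˣ) : L) ∈ Set.range (algebraMap K L)
    · obtain ⟨a, ha⟩ := mem_range_baseToUPrime hu
      rw [← ha, baseCoeff_gamma, baseValue_base baseToUPrime_injective]
      exact Algebra.trace_algebraMap (a : K)
    · rw [baseCoeff_gamma_of_notMem, smul_zero]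
      · refine trace_eq_zero_of_pow_mem hn (fun p hpp hpn x hx => ?_) hi (u : Lˣ).ne_zero
          (pow_mem_range_of_mem_uPrime u.2) hu
        obtain ⟨ζ, hζ⟩ := hp p hpp hpn
        exact mem_range_of_pow_eq_one hpp.ne_zero hζ hx
      · rintro ⟨a, rfl⟩
        exact hu ⟨a, rfl⟩
  exact LinearMap.congr_fun key x

/-- The kernel is an ideal on which the trace vanishes; after division by [L:K] it lies in the
radical of the nondegenerate pairing. -/
theorem uPrimeToField_injective (hn : n ≠ 0) (hc : (Module.finrank K L : K) ≠ 0)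
    (hp : ∀ p : ℕ, p.Prime → p ∣ n → ∃ ζ : K, IsPrimitiveRoot ζ p)
    (hi : 4 ∣ n → ∃ i : K, i ^ 2 = -1) : Function.Injective (uPrimeToField K L n) := by
  rw [injective_iff_map_eq_zero]
  intro x hx
  refine eq_zero_of_baseCoeff_mul_gamma (baseToUPrime_injective (K := K) (L := L)) fun u => ?_
  have h := trace_uPrimeToField hn hp hi (x * gamma _ u)
  rw [map_mul, hx, zero_mul, map_zero, nsmul_eq_mul] at h
  exact (mul_eq_zero.1 h.symm).resolve_left hc

omit [FiniteDimensional K L] [IsGalois K L] in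
/-- `K⟨U'⟩` is isomorphic to `K[U']`. -/
theorem exists_algEquiv_adjoin_uPrime (hinj : Function.Injective (uPrimeToField K L n)) :
    ∃ e : UnivAlg (baseToUPrime K L n) ≃ₐ[K]
        Algebra.adjoin K ((fun u : Lˣ => (u : L)) '' (uPrime K L n : Set Lˣ)),
      ∀ u : uPrime K L n,
        (e (gamma (baseToUPrime K L n) u) : L) = ((u : Lˣ) : L) :=
  ⟨(AlgEquiv.ofInjective _ hinj).trans (Subalgebra.equivOfEq _ _ range_uPrimeToField),
    uPrimeToField_gamma⟩

/-- Every subalgebra of `K⟨U'⟩` is graded. -/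
theorem exists_eq_gradedPart_uPrime (hn : n ≠ 0)
    (hc : ∀ F : IntermediateField K L, (Module.finrank F L : L) ≠ 0)
    (hp : ∀ p : ℕ, p.Prime → p ∣ n → ∃ ζ : K, IsPrimitiveRoot ζ p)
    (hi : 4 ∣ n → ∃ i : K, i ^ 2 = -1) (hinj : Function.Injective (uPrimeToField K L n))
    (E : Subalgebra K (UnivAlg (baseToUPrime K L n))) :
    ∃ D' : Subgroup (uPrime K L n ⧸ (baseToUPrime K L n).range),
      Subalgebra.toSubmodule E = gradedPart (baseToUPrime K L n) D' := by
  set π := uPrimeToField K L n with hπ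
  let F : IntermediateField K L := Algebra.IsAlgebraic.toIntermediateField (E.map π)
  have hmem : ∀ x, π x ∈ F ↔ x ∈ E := fun x =>
    ⟨fun ⟨y, hy, h⟩ => hinj h ▸ hy, fun h => ⟨x, h, rfl⟩⟩
  let S : Subgroup (uPrime K L n) :=
    { carrier := {u | gamma (baseToUPrime K L n) u ∈ E}
      mul_mem' := fun {a b} ha hb => by
        rw [Set.mem_ofPred_eq, map_mul]
        exact mul_mem ha hb
      one_mem' := by
        rw [Set.mem_ofPred_eq, map_one]
        exact one_mem E
      -- `E` is only a subalgebra; inverses come from its image `F`, which is a field by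
      -- algebraicity.
      inv_mem' := fun {a} ha => by
        rw [Set.mem_ofPred_eq, ← hmem, hπ, uPrimeToField_gamma] at ha ⊢
        rw [Subgroup.coe_inv, Units.val_inv_eq_inv_val]
        exact inv_mem ha }
  have hD' : ∀ u : uPrime K L n,
      QuotientGroup.mk u ∈ S.map (QuotientGroup.mk' (baseToUPrime K L n).range) →
        gamma _ u ∈ E := by
    rintro u ⟨v, hv, hvu⟩
    obtain ⟨a, ha⟩ := exists_gamma_eq_smul hvu.symm
    exact ha ▸ E.smul_mem hv _
  refine ⟨S.map (QuotientGroup.mk' _), le_antisymm (fun x hx => ?_) (gradedPart_le hD')⟩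
  set D' := S.map (QuotientGroup.mk' (baseToUPrime K L n).range)
  -- The trace to `F` is [L:F] on `F` and kills elements of U' outside it. Hence it maps the image
  -- of K⟨U'⟩ into that of the graded part, and x in `E` is recovered by dividing by [L:F].
  let T : L →ₗ[K] L := ((Algebra.linearMap F L) ∘ₗ (Algebra.trace F L)).restrictScalars K
  have hT : ∀ y ∈ F, T y = (Module.finrank F L : L) * y := by
    intro y hy
    have h := congrArg (algebraMap F L) (Algebra.trace_algebraMap (S := L) (⟨y, hy⟩ : F))
    rw [nsmul_eq_mul, map_mul, map_natCast] at h
    exact h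
  have hle : Submodule.span K (Set.range (gamma (baseToUPrime K L n))) ≤
      ((gradedPart _ D').map π.toLinearMap).comap (T ∘ₗ π.toLinearMap) := by
    rw [Submodule.span_le]
    rintro _ ⟨u, rfl⟩
    by_cases hu : gamma _ u ∈ E
    · refine ⟨(Module.finrank F L : K) • gamma _ u,
        Submodule.smul_mem _ _ (mem_gradedPart ⟨u, hu, rfl⟩), ?_⟩
      refine Eq.trans ?_ (hT _ ((hmem _).2 hu)).symm
      rw [AlgHom.toLinearMap_apply, map_smul, Algebra.smul_def, map_natCast]
    · have h0 : T (π (gamma _ u)) = 0 := by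
        rw [← hmem, hπ, uPrimeToField_gamma] at hu
        rw [hπ, uPrimeToField_gamma]
        exact (congrArg (algebraMap F L) (trace_eq_zero_of_mem_uPrime hn hp hi F u.2 hu)).trans
          (map_zero _)
      refine ⟨0, zero_mem _, ?_⟩
      rw [map_zero, LinearMap.comp_apply, AlgHom.toLinearMap_apply, h0]
  rw [span_range_gamma] at hle
  obtain ⟨z, hz, hzx⟩ := hle (Submodule.mem_top (x := x))
  have hxF : T (π x) = (Module.finrank F L : L) * π x := hT _ ((hmem x).2 hx)
  have hc' : (Module.finrank F L : K) ≠ 0 := fun h => hc F (by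
    rw [← map_natCast (algebraMap K L), h, map_zero])
  have hzx' : z = (Module.finrank F L : K) • x := by
    apply hinj
    rw [map_smul, Algebra.smul_def, map_natCast, ← hxF]
    exact hzx
  have : x = (Module.finrank F L : K)⁻¹ • z := by rw [hzx', smul_smul, inv_mul_cancel₀ hc', one_smul]
  rw [this]
  exact Submodule.smul_mem _ _ hz

end UPrimeAlgebra

/-! ### The exact sequence -/

section ExactSequence

variable {K L : Type*} [Field K] [Field L] [Algebra K L] {n : ℕ}

theorem rootsToUPrime_injective : Function.Injective (rootsToUPrime K L n) := by
  rw [injective_iff_map_eq_one]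
  intro x hx
  induction x using QuotientGroup.induction_on with
  | H ζ =>
    obtain ⟨a, ha⟩ := (QuotientGroup.eq_one_iff _).1 hx
    have ha' : algebraMap K L (a : K) = ((ζ : Lˣ) : L) := 
      congrArg (fun u : uPrime K L n => ((u : Lˣ) : L)) ha
    have han : a ∈ rootsOfUnity n K := by
      have hζ := (mem_rootsOfUnity' n (ζ : Lˣ)).1 ζ.2
      rw [mem_rootsOfUnity']
      apply (algebraMap K L).injective
      rw [map_pow, ha', hζ, map_one]
    exact (QuotientGroup.eq_one_iff _).2 ⟨⟨a, han⟩, Subtype.ext (Units.ext ha')⟩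

variable [FiniteDimensional K L] [IsGalois K L]

/-- A root of unity ζ and `u` have the same cocycle exactly when ζ/u is fixed by G, i.e. lies in K.
-/
theorem range_rootsToUPrime : (rootsToUPrime K L n).range = (uPrimeToH1 K L n).ker := by
  ext x
  induction x using QuotientGroup.induction_on with
  | H u =>
    have hker : (QuotientGroup.mk u ∈ (uPrimeToH1 K L n).ker) ↔
        ∃ ζ : rootsOfUnity n L, ∀ σ : Gal(L/K), σ • ζ / ζ =
          ⟨σ • (u : Lˣ) / u, smul_div_mem_rootsOfUnity K L n u.2 σ⟩ := QuotientGroup.eq_one_iff _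
    rw [hker]
    constructor
    · rintro ⟨y, hy⟩
      induction y using QuotientGroup.induction_on with
      | H ζ =>
        obtain ⟨a, ha⟩ := QuotientGroup.eq_iff_div_mem.1 hy
        have ha' : Units.map (algebraMap K L).toMonoidHom a = (ζ : Lˣ) / (u : Lˣ) :=
          congrArg Subtype.val ha
        refine ⟨ζ, fun σ => Subtype.ext ?_⟩
        change σ • (ζ : Lˣ) / ζ = σ • (u : Lˣ) / u
        have h := smul_units_map_algebraMap K L σ a
        rw [ha', smul_div', div_eq_div_iff_mul_eq_mul] at h
        rw [div_eq_div_iff_mul_eq_mul, h, mul_comm]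
    · rintro ⟨ζ, hζ⟩
      refine ⟨QuotientGroup.mk ζ, QuotientGroup.eq_iff_div_mem.2 (mem_range_baseToUPrime ?_)⟩
      rw [IsGalois.mem_range_algebraMap_iff_fixed]
      intro σ
      have h : σ • (ζ : Lˣ) / ζ = σ • (u : Lˣ) / u := congrArg Subtype.val (hζ σ)
      have h2 : σ • ((ζ : Lˣ) / u) = (ζ : Lˣ) / u := by
        rw [div_eq_div_iff_mul_eq_mul] at h
        rw [smul_div', div_eq_div_iff_mul_eq_mul, h, mul_comm]
      exact congrArg Units.val h2

omit [IsGalois K L] in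
/-- Surjectivity is Hilbert's Theorem 90. -/
theorem uPrimeToH1_surjective : Function.Surjective (uPrimeToH1 K L n) := by
  intro x
  induction x using QuotientGroup.induction_on with
  | H f =>
    obtain ⟨β, hβ⟩ := groupCohomology.isMulCoboundary₁_of_isMulCocycle₁_of_aut_to_units
      (fun σ : Gal(L/K) => ((f : Gal(L/K) → rootsOfUnity n L) σ : Lˣ))
      (fun σ τ => congrArg Subtype.val (f.2 σ τ))
    have hU : β ∈ uPrime K L n := fun σ =>
      (QuotientGroup.eq_iff_div_mem (N := rootsOfUnity n L)).2 (by
        have h : σ • β / β ∈ rootsOfUnity n L := by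
          rw [hβ σ]
          exact Subtype.property _
        exact h)
    refine ⟨QuotientGroup.mk ⟨β, hU⟩, ?_⟩
    exact congrArg (QuotientGroup.mk (s := (mulCoboundaries₁ Gal(L/K)
      (rootsOfUnity n L)).subgroupOf (mulCocycles₁ Gal(L/K) (rootsOfUnity n L))))
      (Subtype.ext <| funext fun σ => Subtype.ext <| hβ σ)

end ExactSequence

/-! ### Geometric sums and lifting the exponent -/

section GeometricSum

/-- If `s ≡ 1` modulo `p` (modulo `4` if `p = 2`), then `1 + s + ⋯ + s ^ (n - 1)` and `n` are
divisible by the same powers of `p`. -/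
theorem prime_pow_dvd_of_dvd_geom_sum {p k s n : ℕ} (hp : p.Prime) (hs : 1 < s)
    (hs1 : s ≡ 1 [MOD p]) (hs2 : p = 2 → s ≡ 1 [MOD 4])
    (h : p ^ k ∣ ∑ i ∈ Finset.range n, s ^ i) : p ^ k ∣ n := by
  have hpi : Prime (p : ℤ) := Nat.prime_iff_prime_int.1 hp
  have hd : (p : ℤ) ∣ (s : ℤ) - 1 := by
    have := Nat.modEq_iff_dvd.1 hs1.symm
    exact_mod_cast this
  have hps : ¬ (p : ℤ) ∣ (s : ℤ) := fun h =>
    hpi.not_isUnit (isUnit_of_dvd_one (by simpa using dvd_sub h hd))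
  have hm : emultiplicity (p : ℤ) ((s : ℤ) ^ n - 1 ^ n) =
      emultiplicity (p : ℤ) ((s : ℤ) - 1) + emultiplicity p n := by
    rcases hp.eq_two_or_odd' with rfl | hodd
    · have h4 : (4 : ℤ) ∣ (s : ℤ) - 1 := by
        have := Nat.modEq_iff_dvd.1 (hs2 rfl).symm
        exact_mod_cast this
      have := Int.two_pow_sub_pow' n h4 hps
      rw [← Int.natCast_emultiplicity 2 n]
      exact_mod_cast this
    · exact Int.emultiplicity_pow_sub_pow hp hodd hd hps n
  have hg : ((s : ℤ) ^ n - 1 ^ n) = ((s : ℤ) - 1) * ∑ i ∈ Finset.range n, (s : ℤ) ^ i := by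
    rw [one_pow, mul_geom_sum]
  rw [hg, emultiplicity_mul hpi] at hm
  -- Cancelling the valuation of s - 1 requires it to be finite, hence s ≠ 1.
  have hfin : FiniteMultiplicity (p : ℤ) ((s : ℤ) - 1) := by
    rw [Int.finiteMultiplicity_iff]
    exact ⟨by simpa using hp.ne_one, by omega⟩
  have hm' := ENat.add_right_injective_of_ne_top
    (finiteMultiplicity_iff_emultiplicity_ne_top.1 hfin) hm
  rw [pow_dvd_iff_le_emultiplicity, ← hm', ← pow_dvd_iff_le_emultiplicity]
  exact_mod_cast Int.natCast_dvd_natCast.2 h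

/-- If `σ w = ζ w` and `σ ζ = ζ ^ s`, then `σ ^ j` multiplies `w` by `ζ ^ (1 + s + ⋯)`. -/
theorem AlgEquiv.pow_apply_eq_pow_geom_sum_mul {K E : Type*} [Field K] [Field E] [Algebra K E]
    {σ : Gal(E/K)} {ζ w : E} {s : ℕ} (hw : σ w = ζ * w) (hζ : σ ζ = ζ ^ s) (j : ℕ) :
    (σ ^ j) w = ζ ^ (∑ i ∈ Finset.range j, s ^ i) * w := by
  induction j with
  | zero => simp
  | succ j ih =>
    rw [pow_succ', AlgEquiv.mul_apply, ih, map_mul, map_pow, hζ, hw, ← pow_mul, ← mul_assoc,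
      ← pow_succ, geom_sum_succ]

end GeometricSum

/-! ### Homogeneous elements of a co-Galois field extension -/

section CoGaloisGalois

open UnivAlg

variable {K E U : Type*} [Field K] [Field E] [Algebra K E] [CommGroup U] {ι : Kˣ →* U}
  (e : E ≃ₐ[K] UnivAlg ι)

theorem symm_gamma_mul (u v : U) :
    e.symm (gamma ι (u * v)) = e.symm (gamma ι u) * e.symm (gamma ι v) := by
  rw [map_mul, map_mul]

theorem symm_gamma_pow (u : U) (k : ℕ) :
    e.symm (gamma ι (u ^ k)) = e.symm (gamma ι u) ^ k := by
  rw [map_pow, map_pow]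

theorem symm_gamma_ne_zero (u : U) : e.symm (gamma ι u) ≠ 0 := by
  intro h
  have := congrArg e.symm (gamma_mul_gamma_inv ι u)
  rw [map_mul, h, zero_mul, map_one] at this
  exact zero_ne_one this

theorem symm_gamma_mem_range_iff (hι : Function.Injective ι) {u : U} :
    e.symm (gamma ι u) ∈ Set.range (algebraMap K E) ↔ u ∈ ι.range := by
  constructor
  · rintro ⟨a, ha⟩
    refine mem_range_of_gamma_eq hι (a := a) ?_
    rw [← e.commutes, ha, e.apply_symm_apply]
  · rintro ⟨a, rfl⟩
    exact ⟨a, by rw [gamma_base, e.symm.commutes]⟩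

theorem symm_gamma_pow_orderOf_mem_range (u : U) :
    e.symm (gamma ι u) ^ orderOf (u : U ⧸ ι.range) ∈ Set.range (algebraMap K E) := by
  obtain ⟨a, ha⟩ := (QuotientGroup.eq_one_iff (N := ι.range) (u ^ orderOf (u : U ⧸ ι.range))).1
    (by rw [QuotientGroup.mk_pow, pow_orderOf_eq_one])
  rw [← symm_gamma_pow, ← ha]
  exact ⟨a, by rw [gamma_base, e.symm.commutes]⟩

/-- The degree group indexes a K-basis, so its cardinality is [E:K]. -/
theorem orderOf_dvd_finrank (e : E ≃ₐ[K] UnivAlg ι) (hι : Function.Injective ι) (d : U ⧸ ι.range) :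
    orderOf d ∣ Module.finrank K E := by
  rw [Module.finrank_eq_nat_card_basis ((basis hι).map e.symm.toLinearEquiv)]
  exact orderOf_dvd_natCard d

/-- A square root of an element of `K` in a co-Galois extension is homogeneous. -/
theorem IsCoGaloisGroupExtension.exists_eq_smul_of_sq_mem [FiniteDimensional K E]
    (h : IsCoGaloisGroupExtension ι) (h2 : (2 : K) ≠ 0) {x : E}
    (hx : x ^ 2 ∈ Set.range (algebraMap K E)) : ∃ (a : K) (u : U), x = a • e.symm (gamma ι u) := by
  by_cases hxK : x ∈ Set.range (algebraMap K E)
  · obtain ⟨a, rfl⟩ := hxK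
    exact ⟨a, 1, by rw [map_one, map_one, Algebra.algebraMap_eq_smul_one]⟩
  obtain ⟨c, hc⟩ := hx
  have hadj : ∀ y ∈ Algebra.adjoin K {x}, ∃ a b : K, y = algebraMap K E a + algebraMap K E b * x := by
    intro y hy
    induction hy using Algebra.adjoin_induction with
    | mem y hy => exact ⟨0, 1, by rw [Set.mem_singleton_iff.1 hy]; simp⟩
    | algebraMap r => exact ⟨r, 0, by simp⟩
    | add y z _ _ hy hz =>
      obtain ⟨a, b, rfl⟩ := hy
      obtain ⟨a', b', rfl⟩ := hz
      exact ⟨a + a', b + b', by rw [map_add, map_add]; ring⟩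
    | mul y z _ _ hy hz =>
      obtain ⟨a, b, rfl⟩ := hy
      obtain ⟨a', b', rfl⟩ := hz
      refine ⟨a * a' + b * b' * c, a * b' + a' * b, ?_⟩
      simp only [map_add, map_mul, hc]
      ring
  let S := (Algebra.adjoin K {x}).map (e : E →ₐ[K] UnivAlg ι)
  have hS : IsField S := (e.subalgebraMap (Algebra.adjoin K {x})).symm.toMulEquiv.isField
    (Subalgebra.isField_of_algebraic _)
  obtain ⟨D', hD'⟩ := h.graded S hS
  have hmem : ∀ u : U, (u : U ⧸ ι.range) ∈ D' → e.symm (gamma ι u) ∈ Algebra.adjoin K {x} := by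
    intro u hu
    have : gamma ι u ∈ Subalgebra.toSubmodule S := hD' ▸ mem_gradedPart hu
    obtain ⟨y, hy, hyu⟩ := this
    rw [← hyu]
    exact (e.symm_apply_apply y).symm ▸ hy
  obtain ⟨u, huD, hu⟩ : ∃ u : U, (u : U ⧸ ι.range) ∈ D' ∧ u ∉ ι.range := by
    by_contra! hall
    have hle : gradedPart ι D' ≤ Subalgebra.toSubmodule (⊥ : Subalgebra K (UnivAlg ι)) :=
      gradedPart_le fun u hu => by
        obtain ⟨a, rfl⟩ := hall u hu
        exact gamma_base ι a ▸ Subalgebra.algebraMap_mem _ _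
    have hxS : e x ∈ Subalgebra.toSubmodule S := ⟨x, Algebra.self_mem_adjoin_singleton K x, rfl⟩
    obtain ⟨a, ha⟩ := hle (hD' ▸ hxS)
    exact hxK ⟨a, e.injective ((e.commutes a).trans ha)⟩
  obtain ⟨a, b, hab⟩ := hadj _ (hmem u huD)
  have hb : b ≠ 0 := by
    rintro rfl
    rw [map_zero, zero_mul, add_zero] at hab
    exact hu ((symm_gamma_mem_range_iff e h.injective).1 ⟨a, hab.symm⟩)
  have hinv : e.symm (gamma ι u) * e.symm (gamma ι u⁻¹) = 1 := by
    rw [← map_mul, gamma_mul_gamma_inv, map_one]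
  -- u = a + bx satisfies u² = 2au + (b²c - a²); divide by u. As u and its inverse have degrees
  -- other than 1, comparing degree-1 coefficients gives 2a = 0.
  have hrel : e.symm (gamma ι u) =
      algebraMap K E (2 * a) + (b ^ 2 * c - a ^ 2) • e.symm (gamma ι u⁻¹) := by
    have hsq : e.symm (gamma ι u) * e.symm (gamma ι u) =
        algebraMap K E (2 * a) * e.symm (gamma ι u) + algebraMap K E (b ^ 2 * c - a ^ 2) := by
      rw [hab]
      simp only [map_sub, map_mul, map_pow, hc, map_ofNat]
      ring
    calc e.symm (gamma ι u) =
        (e.symm (gamma ι u) * e.symm (gamma ι u)) * e.symm (gamma ι u⁻¹) := by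
          rw [mul_assoc, hinv, mul_one]
      _ = _ := by rw [hsq, add_mul, mul_assoc, hinv, mul_one, Algebra.smul_def]
  have ha : a = 0 := by
    have h0 := congrArg (fun y => baseCoeff h.injective (e y)) hrel
    simp only [map_add, map_smul, AlgEquiv.commutes, AlgEquiv.apply_symm_apply] at h0
    rw [baseCoeff_algebraMap, baseCoeff_gamma_of_notMem _ hu,
      baseCoeff_gamma_of_notMem _ (fun h => hu (inv_mem_iff.1 h)), smul_zero, add_zero] at h0
    exact (mul_eq_zero.1 h0.symm).resolve_left h2
  refine ⟨b⁻¹, u, ?_⟩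
  rw [hab, ha, map_zero, zero_add, ← Algebra.smul_def, smul_smul, inv_mul_cancel₀ hb, one_smul]

/-- Homogeneous elements outside `K` have no component of degree `1`. -/
theorem baseCoeff_eq_zero_of_eq_smul (hι : Function.Injective ι) {x : E} {a : K} {u : U}
    (hx : x = a • e.symm (gamma ι u)) (hxK : x ∉ Set.range (algebraMap K E)) :
    baseCoeff hι (e x) = 0 := by
  have hu : u ∉ ι.range := by
    intro hu
    obtain ⟨b, hb⟩ := (symm_gamma_mem_range_iff e hι).2 hu
    exact hxK ⟨a * b, by rw [hx, ← hb, map_mul, Algebra.smul_def]⟩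
  rw [hx, map_smul, e.apply_symm_apply, map_smul, baseCoeff_gamma_of_notMem hι hu, smul_zero]

variable [FiniteDimensional K E] [IsGalois K E]

/-- If `v` has order `p ^ (k + 1)` in `U / Kˣ`, some automorphism multiplies `v` by a primitive root
of unity of this order. -/
theorem exists_apply_eq_primitiveRoot_mul (hι : Function.Injective ι) {p k : ℕ} (hp : p.Prime)
    {v : U} (hv : orderOf (v : U ⧸ ι.range) = p ^ (k + 1)) :
    ∃ (σ : Gal(E/K)) (ζ : E), IsPrimitiveRoot ζ (p ^ (k + 1)) ∧
      σ (e.symm (gamma ι v)) = ζ * e.symm (gamma ι v) := by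
  have := Fact.mk hp
  set w := e.symm (gamma ι v) with hw
  have hw0 : w ≠ 0 := symm_gamma_ne_zero e v
  have h1 : w ^ p ^ (k + 1) ∈ Set.range (algebraMap K E) :=
    hv ▸ symm_gamma_pow_orderOf_mem_range e v
  have h2 : w ^ p ^ k ∉ Set.range (algebraMap K E) := by
    rw [hw, ← symm_gamma_pow, symm_gamma_mem_range_iff e hι, ← QuotientGroup.eq_one_iff,
      QuotientGroup.mk_pow, ← orderOf_dvd_iff_pow_eq_one, hv, Nat.pow_dvd_pow_iff_le_right hp.one_lt]
    omega
  -- Some σ moves w^(p^k) but fixes w^(p^(k+1)), so σw/w has exact order p^(k+1).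
  rw [IsGalois.mem_range_algebraMap_iff_fixed] at h1 h2
  push Not at h2
  obtain ⟨σ, hσ⟩ := h2
  refine ⟨σ, σ w / w, ?_, (div_mul_cancel₀ _ hw0).symm⟩
  rw [IsPrimitiveRoot.iff_orderOf]
  refine orderOf_eq_prime_pow ?_ ?_
  · rwa [div_pow, div_eq_one_iff_eq (pow_ne_zero _ hw0), ← map_pow]
  · rw [div_pow, ← map_pow, h1 σ, div_self (pow_ne_zero _ hw0)]

end CoGaloisGalois

/-! ### The exponent of the degree group -/

section CoGaloisExponent

open UnivAlg

variable {K E U : Type*} [Field K] [Field E] [Algebra K E] [CommGroup U] {ι : Kˣ →* U}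
  [FiniteDimensional K E] [IsGalois K E]

/-- A Galois co-Galois extension whose degree group has an element of order `4` has a Galois group
of exponent divisible by `4`. -/
theorem four_dvd_of_orderOf_eq_four (e : E ≃ₐ[K] UnivAlg ι) (h : IsCoGaloisGroupExtension ι)
    {n : ℕ} (hn : ∀ σ : Gal(E/K), σ ^ n = 1) {v : U} (hv : orderOf (v : U ⧸ ι.range) = 4) :
    4 ∣ n := by
  have hι := h.injective
  by_contra h4
  obtain ⟨σ, i, hi, hσ⟩ := exists_apply_eq_primitiveRoot_mul e hι Nat.prime_two (k := 1) (v := v) hv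
  norm_num at hi
  set w := e.symm (gamma ι v) with hw
  have hw0 : w ≠ 0 := symm_gamma_ne_zero e v
  have hi2 : i ^ 2 = -1 := hi.sq_eq_neg_one
  have hi0 : i ≠ 0 := hi.ne_zero (by norm_num)
  have hE2 : (2 : E) ≠ 0 := by
    intro h2
    have : i ^ 2 = 1 := by rw [hi2]; linear_combination -h2
    exact absurd (hi.dvd_of_pow_eq_one 2 this) (by norm_num)
  have hK2 : (2 : K) ≠ 0 := fun h2 => hE2 (by rw [← map_ofNat (algebraMap K E), h2, map_zero])
  have hini : i ≠ -i := by
    intro h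
    have : 2 * i = 0 := by linear_combination h
    exact (mul_ne_zero hE2 hi0) this
  have hor : ∀ ρ : Gal(E/K), ρ i = i ∨ ρ i = -i := by
    intro ρ
    rw [← sq_eq_sq_iff_eq_or_eq_neg, ← map_pow, hi2, map_neg, map_one]
  -- If ρ fixed i, then ρ^n = 1 would give i^(rn) = 1 and so 4 ∣ n.
  have hodd : ∀ (ρ : Gal(E/K)) (r : ℕ), Nat.Coprime 4 r → ρ w = i ^ r * w → ρ i = -i := by
    intro ρ r hr hρ
    refine (hor ρ).resolve_left fun hρi => h4 ?_
    have hρr : ρ (i ^ r) = (i ^ r) ^ 1 := by rw [map_pow, hρi, pow_one]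
    have := AlgEquiv.pow_apply_eq_pow_geom_sum_mul hρ hρr n
    simp only [hn, AlgEquiv.one_apply, one_pow, Finset.sum_const, Finset.card_range, smul_eq_mul,
      mul_one] at this
    have h1 := (mul_eq_right₀ hw0).1 this.symm
    rw [← pow_mul] at h1
    exact hr.dvd_of_dvd_mul_left (hi.dvd_of_pow_eq_one _ h1)
  have hσi : σ i = -i := hodd σ 1 (by norm_num) (by rw [pow_one, hσ])
  have hconj : ∀ ρ : Gal(E/K), ∃ r, ρ w = i ^ r * w := by
    intro ρ
    have h1 : (ρ w / w) ^ 4 = 1 := by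
      have h2 := symm_gamma_pow_orderOf_mem_range e v
      rw [hv, IsGalois.mem_range_algebraMap_iff_fixed] at h2
      rw [div_pow, ← map_pow, h2 ρ, div_self (pow_ne_zero _ hw0)]
    obtain ⟨r, -, hr⟩ := hi.eq_pow_of_pow_eq_one h1
    exact ⟨r, by rw [hr, div_mul_cancel₀ _ hw0]⟩
  have hcop : ∀ r : ℕ, Odd r → Nat.Coprime 4 r := fun r hr =>
    (Nat.coprime_two_left.2 hr).pow_left 2
  have hfix : ∀ ρ : Gal(E/K), ρ (i * w ^ 2) = i * w ^ 2 := by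
    intro ρ
    obtain ⟨r, hr⟩ := hconj ρ
    rw [map_mul, map_pow, hr, mul_pow, ← pow_mul, mul_comm r 2, pow_mul, hi2]
    rcases Nat.even_or_odd r with he | ho
    · have hρi : ρ i = i := by
        refine (hor ρ).resolve_right fun hρi => hini ?_
        have h1 : (ρ * σ) w = i ^ (r + 3) * w := by
          rw [AlgEquiv.mul_apply, hσ, map_mul, hρi, hr, pow_add, pow_succ i 2, hi2]
          ring
        have h2 := hodd (ρ * σ) (r + 3) (hcop _ (he.add_odd (by decide))) h1
        rwa [AlgEquiv.mul_apply, hσi, map_neg, hρi, neg_neg] at h2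
      rw [hρi, he.neg_one_pow, one_mul]
    · rw [hodd ρ r (hcop r ho) hr, ho.neg_one_pow]
      ring
  have hiK : i ∉ Set.range (algebraMap K E) := by
    rintro ⟨a, ha⟩
    rw [← ha, σ.commutes, ha] at hσi
    exact hini hσi
  obtain ⟨a, u, hau⟩ := h.exists_eq_smul_of_sq_mem e hK2 (x := i)
    ⟨-1, by rw [hi2, map_neg, map_one]⟩
  -- The square of (1+i)w is 2iw², which lies in K. So (1+i)w is homogeneous, hence so is 1+i; but 1
  -- is the degree-1 component of 1+i, and 1+i is not in K.
  obtain ⟨b, u', hbu⟩ := h.exists_eq_smul_of_sq_mem e hK2 (x := (1 + i) * w) (by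
    rw [IsGalois.mem_range_algebraMap_iff_fixed]
    intro ρ
    have : ((1 + i) * w) ^ 2 = 2 * (i * w ^ 2) := by linear_combination w ^ 2 * hi2
    rw [this, map_mul, hfix, map_ofNat])
  have h1i : 1 + i = b • e.symm (gamma ι (u' * v⁻¹)) := by
    rw [symm_gamma_mul, ← smul_mul_assoc, ← hbu, hw, mul_assoc, ← map_mul e.symm,
      gamma_mul_gamma_inv, map_one, mul_one]
  have h1iK : 1 + i ∉ Set.range (algebraMap K E) := by
    rintro ⟨c, hc⟩
    exact hiK ⟨c - 1, by rw [map_sub, map_one, hc, add_sub_cancel_left]⟩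
  have hz := baseCoeff_eq_zero_of_eq_smul e hι h1i h1iK
  rw [map_add, map_add, map_one, baseCoeff_one, baseCoeff_eq_zero_of_eq_smul e hι hau hiK,
    add_zero] at hz
  exact one_ne_zero hz

/-- If `E|K` is Galois and co-Galois and `K` contains enough roots of unity, then the exponent of
the degree group divides that of the Galois group. -/
theorem orderOf_dvd_of_forall_pow_eq_one (e : E ≃ₐ[K] UnivAlg ι) (h : IsCoGaloisGroupExtension ι)
    {n : ℕ} (hn : ∀ σ : Gal(E/K), σ ^ n = 1)
    (hdvd : ∀ p : ℕ, p.Prime → p ∣ Module.finrank K E → p ∣ n)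
    (hp : ∀ p : ℕ, p.Prime → p ∣ n → ∃ ζ : K, IsPrimitiveRoot ζ p)
    (hi : 4 ∣ n → ∃ ζ : K, IsPrimitiveRoot ζ 4) (u : U) : orderOf (u : U ⧸ ι.range) ∣ n := by
  have hι := h.injective
  have hm0 : orderOf (u : U ⧸ ι.range) ≠ 0 := fun h0 =>
    Module.finrank_pos.ne' (Nat.eq_zero_of_zero_dvd (h0 ▸ orderOf_dvd_finrank e hι (u : U ⧸ ι.range)))
  have hpow : ∀ q, q ∣ orderOf (u : U ⧸ ι.range) → ∃ v : U, orderOf (v : U ⧸ ι.range) = q := by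
    intro q hq
    refine ⟨u ^ (orderOf (u : U ⧸ ι.range) / q), ?_⟩
    rw [QuotientGroup.mk_pow]
    exact orderOf_pow_orderOf_div hm0 hq
  rw [Nat.dvd_iff_prime_pow_dvd_dvd]
  rintro p (_ | k) hpp hk
  · exact one_dvd n
  have hpn : p ∣ n := hdvd p hpp
    (((dvd_pow_self p k.succ_ne_zero).trans hk).trans (orderOf_dvd_finrank e hι _))
  obtain ⟨v, hv⟩ := hpow _ hk
  obtain ⟨σ, ζ, hζ, hσ⟩ := exists_apply_eq_primitiveRoot_mul e hι hpp hv
  have : NeZero (p ^ (k + 1)) := ⟨pow_ne_zero _ hpp.ne_zero⟩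
  obtain ⟨s, -, hs⟩ := hζ.eq_pow_of_pow_eq_one
    (show (σ ζ) ^ p ^ (k + 1) = 1 by rw [← map_pow, hζ.pow_eq_one, map_one])
  -- ζ^t is a primitive r-th root of unity lying in K, so σ fixes it and s ≡ 1 mod r.
  have hfixed : ∀ r, r ≠ 0 → r ∣ p ^ (k + 1) → (∃ η : K, IsPrimitiveRoot η r) → s ≡ 1 [MOD r] := by
    rintro r hr0 ⟨t, ht⟩ ⟨η, hη⟩
    have hrt : IsPrimitiveRoot (ζ ^ t) r :=
      hζ.pow (NeZero.pos _) (by rw [ht, mul_comm])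
    obtain ⟨c, hc⟩ := mem_range_of_pow_eq_one hr0 hη hrt.pow_eq_one
    have h1 : (ζ ^ t) ^ s = (ζ ^ t) ^ 1 := by
      rw [pow_one, ← pow_mul, mul_comm, pow_mul, hs, ← map_pow, ← hc, σ.commutes]
    have hfin : IsOfFinOrder (ζ ^ t) :=
      isOfFinOrder_iff_pow_eq_one.2 ⟨r, Nat.pos_of_ne_zero hr0, hrt.pow_eq_one⟩
    rwa [hfin.pow_eq_pow_iff_modEq, ← hrt.eq_orderOf] at h1
  rcases k with _ | k
  · simpa using hpn
  have hs1 := hfixed p hpp.ne_zero (dvd_pow_self p (by omega)) (hp p hpp hpn)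
  have hs4 : p = 2 → s ≡ 1 [MOD 4] := by
    rintro rfl
    have h4 : 4 ∣ 2 ^ (k + 1 + 1) := ⟨2 ^ k, by ring⟩
    obtain ⟨v', hv'⟩ := hpow 4 (h4.trans hk)
    exact hfixed 4 (by norm_num) h4 (hi (four_dvd_of_orderOf_eq_four e h hn hv'))
  -- The shift makes the exponent exceed 1 without changing it modulo 4, p or the order of ζ.
  have hσζ : σ ζ = ζ ^ (s + 4 * p ^ (k + 1 + 1)) := by
    rw [pow_add, hs, mul_comm 4, pow_mul, hζ.pow_eq_one, one_pow, mul_one]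
  have hsum := AlgEquiv.pow_apply_eq_pow_geom_sum_mul hσ hσζ n
  rw [hn, AlgEquiv.one_apply] at hsum
  have h1 := (mul_eq_right₀ (symm_gamma_ne_zero e v)).1 hsum.symm
  refine prime_pow_dvd_of_dvd_geom_sum hpp ?_ ?_ ?_ (hζ.dvd_of_pow_eq_one _ h1)
  · have := NeZero.pos (p ^ (k + 1 + 1))
    omega
  · refine (Nat.modEq_zero_iff_dvd.2 ?_).add_left s |>.trans hs1
    exact (dvd_pow_self p (by omega)).mul_left 4
  · intro h2
    exact ((Nat.modEq_zero_iff_dvd.2 (dvd_mul_right 4 _)).add_left s).trans (hs4 h2)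

end CoGaloisExponent

/-! ### K[U'] is Galois and contains every Galois co-Galois subfield -/

section Maximality

open UnivAlg

variable {K L : Type*} [Field K] [Field L] [Algebra K L] [FiniteDimensional K L] [IsGalois K L]

/-- Every Galois co-Galois intermediate field is contained in `K[U']`. -/
theorem le_adjoin_uPrime_of_isCoGaloisExtension {n : ℕ} (hn : n = Monoid.exponent Gal(L/K))
    (hp : ∀ p : ℕ, p.Prime → p ∣ n → ∃ ζ : K, IsPrimitiveRoot ζ p)
    (hi : 4 ∣ n → ∃ ζ : K, IsPrimitiveRoot ζ 4) (E : IntermediateField K L) [IsGalois K E]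
    (hE : IsCoGaloisExtension K E) :
    E.toSubalgebra ≤ Algebra.adjoin K ((fun u : Lˣ => (u : L)) '' (uPrime K L n : Set Lˣ)) := by
  obtain ⟨U, _, ι, h, ⟨e⟩⟩ := hE
  have hgal : ∀ τ : Gal(E/K), τ ^ n = 1 := by
    intro τ
    obtain ⟨σ, rfl⟩ := AlgEquiv.restrictNormalHom_surjective (F := K) (K₁ := E) L τ
    rw [← map_pow, hn, Monoid.pow_exponent_eq_one, map_one]
  have hdvd : ∀ p : ℕ, p.Prime → p ∣ Module.finrank K E → p ∣ n := by
    intro p hpp hpE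
    rw [hn]
    apply hpp.dvd_exponent
    rw [IsGalois.card_aut_eq_finrank]
    exact hpE.trans ⟨_, (Module.finrank_mul_finrank K E L).symm⟩
  have hgen : ∀ u : U, ((e.symm (gamma ι u) : E) : L) ∈
      Algebra.adjoin K ((fun u : Lˣ => (u : L)) '' (uPrime K L n : Set Lˣ)) := by
    intro u
    have h0 : ((e.symm (gamma ι u) : E) : L) ≠ 0 := fun h0 =>
      symm_gamma_ne_zero e u (Subtype.ext h0)
    -- The order of the degree of `u` divides n, so the n-th power lies in K.
    refine Algebra.subset_adjoin ⟨Units.mk0 _ h0, mem_uPrime_iff.2 fun σ => ?_, rfl⟩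
    obtain ⟨m, hm⟩ := orderOf_dvd_of_forall_pow_eq_one e h hgal hdvd hp hi u
    obtain ⟨a, ha⟩ := symm_gamma_pow_orderOf_mem_range e u
    have ha' : (((e.symm (gamma ι u) : E) : L)) ^ n = algebraMap K L (a ^ m) := by
      rw [hm, pow_mul, map_pow, IsScalarTower.algebraMap_apply K E L, ha]
      rfl
    rw [Units.val_mk0, ← map_pow, ha', σ.commutes]
  intro x hx
  have hspan : e ⟨x, hx⟩ ∈ Submodule.span K (Set.range (gamma ι)) := by
    rw [span_range_gamma]; trivial
  have hle : Submodule.span K (Set.range (gamma ι)) ≤ (Subalgebra.toSubmodule (Algebra.adjoin K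
      ((fun u : Lˣ => (u : L)) '' (uPrime K L n : Set Lˣ)))).comap
        (E.val.toLinearMap ∘ₗ e.symm.toLinearMap) := by
    rw [Submodule.span_le]
    rintro _ ⟨u, rfl⟩
    exact hgen u
  have := hle hspan
  rwa [Submodule.mem_comap, LinearMap.comp_apply, AlgEquiv.toLinearMap_apply,
    AlgEquiv.symm_apply_apply] at this

omit [FiniteDimensional K L] in
/-- `K[U']` is a Galois extension of `K`. -/
theorem isGalois_of_eq_adjoin_uPrime {n : ℕ} {F : IntermediateField K L}
    (hF : F.toSubalgebra =
      Algebra.adjoin K ((fun u : Lˣ => (u : L)) '' (uPrime K L n : Set Lˣ))) :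
    IsGalois K F := by
  have hstab : ∀ σ : Gal(L/K), F.toSubalgebra ≤ F.toSubalgebra.comap (σ : L →ₐ[K] L) := by
    intro σ
    conv_lhs => rw [hF]
    rw [Algebra.adjoin_le_iff, hF]
    rintro _ ⟨u, hu, rfl⟩
    refine Algebra.subset_adjoin ⟨σ • u, ?_, rfl⟩
    -- σu = (σu/u)·u is a root of unity times u.
    have := mul_mem (rootsOfUnity_le_uPrime K L n (smul_div_mem_rootsOfUnity K L n hu σ)) hu
    rwa [div_mul_cancel] at this
  have : Normal K F := by
    rw [IntermediateField.normal_iff_forall_map_le']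
    rintro σ _ ⟨x, hx, rfl⟩
    exact hstab σ hx
  exact ⟨⟩

end Maximality

/-! ### Assembly of the theorem -/

theorem mainTheorem7 {K L : Type*} [Field K] [Field L] [Algebra K L]
    [FiniteDimensional K L] [IsGalois K L]
    (n : ℕ) (hn : n = Monoid.exponent Gal(L/K))
    (hL : Nat.card (rootsOfUnity n L) = n)
    (hK : Nat.card (rootsOfUnity (extendedReduction n) K) = extendedReduction n) :
    -- `K⟨U'⟩` is a field
    IsField (UnivAlg (baseToUPrime K L n)) ∧
    -- it is canonically isomorphic to the subalgebra `K[U']` of `L`, which is thus a subfield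
    (∃ e : UnivAlg (baseToUPrime K L n) ≃ₐ[K]
        Algebra.adjoin K ((fun u : Lˣ => (u : L)) '' (uPrime K L n : Set Lˣ)),
      ∀ u : uPrime K L n,
        (e (UnivAlg.gamma (baseToUPrime K L n) u) : L) = ((u : Lˣ) : L)) ∧
    -- the sequence `1 → μ_n(L)/μ_n(K) → U'/Kˣ → H¹(G, μ_n(L)) → 1` is exact
    (Function.Injective (rootsToUPrime K L n) ∧
      (rootsToUPrime K L n).range = (uPrimeToH1 K L n).ker ∧
      Function.Surjective (uPrimeToH1 K L n)) ∧
    -- the group extension `Kˣ ↪ U'` is co-Galois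
    IsCoGaloisGroupExtension (baseToUPrime K L n) ∧
    -- `K[U']` is a subfield of `L`, Galois and co-Galois over `K`, and the largest such
    ∃ F : IntermediateField K L,
      F.toSubalgebra =
        Algebra.adjoin K ((fun u : Lˣ => (u : L)) '' (uPrime K L n : Set Lˣ)) ∧
      IsGreatest {E : IntermediateField K L | IsGalois K E ∧ IsCoGaloisExtension K E} F := by
  have hn0 : n ≠ 0 := hn ▸ Monoid.exponent_ne_zero_of_finite
  obtain ⟨ξ, hξ⟩ := exists_isPrimitiveRoot_of_card_rootsOfUnity (extendedReduction_ne_zero n) hK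
  have hroots : ∀ r, r ∣ extendedReduction n → ∃ ζ : K, IsPrimitiveRoot ζ r := by
    rintro r ⟨t, ht⟩
    exact ⟨ξ ^ t, hξ.pow (Nat.pos_of_ne_zero (extendedReduction_ne_zero n)) (by rw [ht, mul_comm])⟩
  have hp : ∀ p : ℕ, p.Prime → p ∣ n → ∃ ζ : K, IsPrimitiveRoot ζ p := fun p hpp hpn =>
    hroots p (hpp.dvd_extendedReduction hn0 hpn)
  have h4 : 4 ∣ n → ∃ ζ : K, IsPrimitiveRoot ζ 4 := fun h =>
    hroots 4 (four_dvd_extendedReduction hn0 h)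
  have hi : 4 ∣ n → ∃ i : K, i ^ 2 = -1 := fun h => (h4 h).imp fun _ hζ => hζ.sq_eq_neg_one
  obtain ⟨ω, hω⟩ := exists_isPrimitiveRoot_of_card_rootsOfUnity hn0 hL
  -- A primitive n-th root of unity exists only if the characteristic does not divide n.
  have hnL : (n : L) ≠ 0 := by
    have : NeZero n := ⟨hn0⟩
    exact (hω.neZero').ne
  have hcard : Nat.card Gal(L/K) = Module.finrank K L := IsGalois.card_aut_eq_finrank K L
  have hc : ∀ F : IntermediateField K L, (Module.finrank F L : L) ≠ 0 := fun F =>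
    natCast_ne_zero_of_dvd_card (G := Gal(L/K))
      (hcard ▸ ⟨_, ((Module.finrank_mul_finrank K F L).symm.trans (mul_comm _ _))⟩) (hn ▸ hnL)
  have hcK : (Module.finrank K L : K) ≠ 0 := fun h0 =>
    natCast_ne_zero_of_dvd_card (G := Gal(L/K)) (F := L) dvd_rfl (hn ▸ hnL)
      (by rw [hcard, ← map_natCast (algebraMap K L), h0, map_zero])
  have hinj := uPrimeToField_injective hn0 hcK hp hi
  obtain ⟨e, he⟩ := exists_algEquiv_adjoin_uPrime hinj
  have hfield : IsField (UnivAlg (baseToUPrime K L n)) :=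
    e.toMulEquiv.isField (Subalgebra.isField_of_algebraic _)
  have hcog : IsCoGaloisGroupExtension (baseToUPrime K L n) := by
    refine ⟨baseToUPrime_injective, hfield, fun ℓ hℓ _ d k hd => ?_, fun E _ =>
      exists_eq_gradedPart_uPrime hn0 hc hp hi hinj E⟩
    -- The degree group is killed by n, which is prime to ℓ.
    have hdn : d ^ n = 1 := by
      induction d using QuotientGroup.induction_on with
      | H u =>
        rw [← QuotientGroup.mk_pow, QuotientGroup.eq_one_iff]
        refine mem_range_baseToUPrime ?_
        exact pow_mem_range_of_mem_uPrime u.2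
    have hcop : Nat.Coprime (ℓ ^ k) n := by
      refine Nat.Coprime.pow_left k ((Nat.Prime.coprime_iff_not_dvd hℓ).2 fun hdvd => hnL ?_)
      have h0 : (n : K) = 0 := (CharP.cast_eq_zero_iff K ℓ n).2 hdvd
      rw [← map_natCast (algebraMap K L), h0, map_zero]
    have := pow_gcd_eq_one.2 ⟨hd, hdn⟩
    rwa [hcop.gcd_eq_one, pow_one] at this
  refine ⟨hfield, ⟨e, he⟩, ⟨rootsToUPrime_injective, range_rootsToUPrime, uPrimeToH1_surjective⟩,
    hcog, Algebra.IsAlgebraic.toIntermediateField _, rfl, ⟨isGalois_of_eq_adjoin_uPrime rfl, ?_⟩, ?_⟩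
  · exact ⟨uPrime K L n, inferInstance, baseToUPrime K L n, hcog, ⟨e.symm⟩⟩
  · rintro E ⟨hE, hE'⟩
    exact le_adjoin_uPrime_of_isCoGaloisExtension hn hp h4 E hE'
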